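/- **Notation.** Let $p\ge 3$ be an integer. $\mathfrak G$ is the $p$-adic Vilenkin group: the group of sequences $x=(x_k)_{k\in\mathbb Z}$, $x_k\in\mathbb Z/p\mathbb Z$, with only finitely many nonzero $x_k$ of negative index, with coordinatewise addition and the topology whose base is formed by the cosets of the subgroups $\mathfrak G_n=\{x: x_k=0 \text{ for } k<n\}$. Let $g_n\in\mathfrak G$ be the sequence with $1$ at index $n$ and $0$ elsewhere, and let $\mathcal A$ be the dilation $(\mathcal Ax)_k=x_{k+1}$. $X$ is the group of characters of $\mathfrak G$, $(\chi,x)$ is the value of $\chi\in X$ at $x\in\mathfrak G$, $\mathfrak G_n^\perp\subset X$ is the annihilator of $\mathfrak G_n$, $(\chi\mathcal A^{\pm1},x)=(\chi,\mathcal A^{\pm1}x)$, and $r_n\in X$ is given by $(r_n,x)=e^{2\pi i x_n/p}$. Digits $\alpha_\nu$ range over $V=\{0,\dots,p-1\}$. Let $N,M\ge1$ be integers. * $\mathfrak D_{-N}(\mathfrak G_M^\perp)$ is the set of functions $X\to\mathbb C$ supported in $\mathfrak G_M^\perp$ and constant on the cosets of $\mathfrak G_{-N}^\perp$. * A set $E\subset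 X$ is $(N,M)$-elementary if it is the disjoint union of $p^N$ cosets $\mathfrak G_{-N}^\perp\xi_\alpha\eta_\alpha$, one for each $\alpha=(\alpha_{-N},\dots,\alpha_{-1})\in V^N$, where $\xi_\alpha=r_{-N}^{\alpha_{-N}}\cdots r_{-1}^{\alpha_{-1}}$ and $\eta_\alpha=r_0^{\alpha_0}\cdots r_{M-1}^{\alpha_{M-1}}$ with some digits $\alpha_0,\dots,\alpha_{M-1}$ depending on $\alpha$, such that $\mathfrak G_0^\perp$ is the disjoint union of the cosets $\mathfrak G_{-N}^\perp\xi_\alpha$, the coset that belongs to $\alpha=(0,\dots,0)$ is $\mathfrak G_{-N}^\perp\xi_0\eta_0=\mathfrak G_{-N}^\perp$, and $E\cap(\mathfrak G_{-N+l+1}^\perp\setminus\mathfrak G_{-N+l}^\perp)\ne\emptyset$ for $l=0,1,\dots,M+N-1$. * An $N$-elementary mask is a function $m_0(\chi)=\frac1p\sum_{h\in H_0^{(N+1)}}\beta_h\overline{(\chi\mathcal A^{-1},h)}$ with $\beta_h\in\mathbb C$ and $H_0^{(N+1)}=\{a_{-1}g_{-1}+\dots+a_{-N-1}g_{-N-1}: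 a_j\in V\}$, which is constant on the cosets of $\mathfrak G_{-N}^\perp$, has $|m_0(\chi)|\in\{0,1\}$ for all $\chi$, and equals $1$ on $\mathfrak G_{-N}^\perp$. * Let $T$ be a finite rooted tree with vertices labelled by elements of $V$. A vertex at distance $i$ from the root has level $i$. Paths are directed away from the root. The height of $T$ is the number of vertices of a longest path. $T$ is $N$-valid if all vertices of the levels $0,1,\dots,N-1$ have label $0$, and for each $(\alpha_1,\dots,\alpha_N)\in V^N$ there is exactly one path with $N$ vertices in $T$ whose successive labels are $\alpha_1,\dots,\alpha_N$. * For such a tree $T$ let $\tilde E\subset X$ be the union, over all paths of $T$ with $s+N+1$ vertices ($s\ge 0$) and labels $\alpha_s\to\alpha_{s-1}\to\dots\to\alpha_{-N}$ with $\alpha_s=\dots=\alpha_{s-N+1}=0$, of the cosets $\mathfrak G_{-N}^\perp r_{-N}^{\alpha_{t-N}}r_{-N+1}^{\alpha_{t-N+1}}\cdots r_0^{\alpha_t}$ for $0\le t\le s$ and $\mathfrak G_{-N}^\perp r_{-N}^{\alpha_{t-N}}\cdots r_{s-t}^{\alpha_s}$ for $s<t\le s+N$. Let $\tilde E_X=\bigcup_{s\ge1}\bigcup_{\alpha_1,\dots,\alpha_s\in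 V}\tilde E\,r_1^{\alpha_1}\cdots r_s^{\alpha_s}$. $T$ generates the set $E$ if $E=\bigcap_{n\ge0}\tilde E_X\mathcal A^n$, where $S\mathcal A^n=\{\chi\mathcal A^n:\chi\in S\}$. **Theorem 4.1.** Let $p\ge3$ and $N,M\ge1$ be integers. Let $E\subset\mathfrak G_M^\perp$ be an $(N,M)$-elementary set and let $\hat\varphi\in\mathfrak D_{-N}(\mathfrak G_M^\perp)$ satisfy $|\hat\varphi(\chi)|=\mathbf 1_E(\chi)$ for all $\chi\in X$. Suppose that $\hat\varphi(\chi)=m_0(\chi)\,\hat\varphi(\chi\mathcal A^{-1})$ for all $\chi\in X$, where $m_0$ is an $N$-elementary mask. Then there exists a finite rooted $N$-valid tree, with vertices labelled by elements of $V$, that has height $M+2N$ and generates the set $E$. -/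

import Mathlib

noncomputable section

namespace Vilenkin

/-! ## The group `𝔊`, its chain of subgroups, its topology and its dilation -/

/-- Two-sided sequences over `ZMod p` with finitely many nonzero terms of negative index. -/
def seqSubgroup (p : ℕ) : AddSubgroup (ℤ → ZMod p) where
  carrier := {x | ∃ m : ℤ, ∀ k < m, x k = 0}
  zero_mem' := ⟨0, fun _ _ => rfl⟩
  add_mem' := by
    rintro x y ⟨m, hm⟩ ⟨n, hn⟩
    refine ⟨min m n, fun k hk => ?_⟩
    simp [hm k (lt_of_lt_of_le hk (min_le_left _ _)),
      hn k (lt_of_lt_of_le hk (min_le_right _ _))]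
  neg_mem' := by
    rintro x ⟨m, hm⟩
    exact ⟨m, fun k hk => by simp [hm k hk]⟩

/-- The `p`-adic Vilenkin group, with coordinatewise addition modulo `p`. -/
def VilenkinGroup (p : ℕ) : Type := seqSubgroup p

instance (p : ℕ) : AddCommGroup (VilenkinGroup p) := inferInstanceAs (AddCommGroup (seqSubgroup p))

variable {p : ℕ}

/-- The `k`-th coordinate, as a homomorphism. -/
def coord (k : ℤ) : VilenkinGroup p →+ ZMod p :=
  (Pi.evalAddMonoidHom (fun _ : ℤ => ZMod p) k).comp (seqSubgroup p).subtype

/-- The basic chain: `chain n` is the subgroup `𝔊_n` of sequences vanishing at all indices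
below `n`. -/
def chain (p : ℕ) (n : ℤ) : AddSubgroup (VilenkinGroup p) where
  carrier := {x | ∀ k < n, coord k x = 0}
  zero_mem' := fun k _ => map_zero (coord k)
  add_mem' := fun {x y} hx hy k hk => by rw [map_add, hx k hk, hy k hk, add_zero]
  neg_mem' := fun {x} hx k hk => by rw [map_neg, hx k hk, neg_zero]

/-- The topology whose base is formed by the cosets `𝔊_n + g`. -/
instance (p : ℕ) : TopologicalSpace (VilenkinGroup p) :=
  TopologicalSpace.generateFrom {U | ∃ (n : ℤ) (g : VilenkinGroup p), U = {x | x - g ∈ chain p n}}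

/-- The basic element `g_n`: coordinate `1` at the index `n` and `0` elsewhere. -/
def basicElt (p : ℕ) (n : ℤ) : VilenkinGroup p :=
  ⟨Pi.single n 1, n, fun _ hk => Pi.single_eq_of_ne (ne_of_lt hk) _⟩

/-- The dilation `𝓐 (∑ aₙ gₙ) = ∑ aₙ gₙ₋₁`, that is `(𝓐 x)ₖ = xₖ₊₁`. -/
def dilation (p : ℕ) : VilenkinGroup p ≃+ VilenkinGroup p where
  toFun x := ⟨fun k => coord (k + 1) x, by
    obtain ⟨m, hm⟩ := x.2
    exact ⟨m - 1, fun k hk => hm (k + 1) (by omega)⟩⟩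
  invFun x := ⟨fun k => coord (k - 1) x, by
    obtain ⟨m, hm⟩ := x.2
    exact ⟨m + 1, fun k hk => hm (k - 1) (by omega)⟩⟩
  left_inv x := Subtype.ext (funext fun k => congrArg x.1 (by ring))
  right_inv x := Subtype.ext (funext fun k => congrArg x.1 (by ring))
  map_add' _ _ := rfl

theorem coord_dilation (x : VilenkinGroup p) (k : ℤ) : coord k (dilation p x) = coord (k + 1) x := rfl

theorem coord_dilation_symm (x : VilenkinGroup p) (k : ℤ) :
    coord k ((dilation p).symm x) = coord (k - 1) x := rfl

theorem isOpen_coset (n : ℤ) (g : VilenkinGroup p) : IsOpen {x : VilenkinGroup p | x - g ∈ chain p n} :=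
  TopologicalSpace.isOpen_generateFrom_of_mem ⟨n, g, rfl⟩

theorem continuous_dilation : Continuous (dilation p) := by
  refine continuous_generateFrom_iff.2 ?_
  rintro _ ⟨n, g, rfl⟩
  convert isOpen_coset (n + 1) ((dilation p).symm g) using 1
  ext x
  constructor
  · intro h k hk
    have h1 := h (k - 1) (by omega)
    rw [map_sub, coord_dilation, sub_add_cancel] at h1
    rw [map_sub, coord_dilation_symm]
    exact h1
  · intro h k hk
    have h1 := h (k + 1) (by omega)
    rw [map_sub, coord_dilation_symm, add_sub_cancel_right] at h1
    rw [map_sub, coord_dilation]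
    exact h1

theorem continuous_dilation_symm : Continuous (dilation p).symm := by
  refine continuous_generateFrom_iff.2 ?_
  rintro _ ⟨n, g, rfl⟩
  convert isOpen_coset (n - 1) (dilation p g) using 1
  ext x
  constructor
  · intro h k hk
    have h1 := h (k + 1) (by omega)
    rw [map_sub, coord_dilation_symm, add_sub_cancel_right] at h1
    rw [map_sub, coord_dilation]
    exact h1
  · intro h k hk
    have h1 := h (k - 1) (by omega)
    rw [map_sub, coord_dilation, sub_add_cancel] at h1
    rw [map_sub, coord_dilation_symm]
    exact h1

/-! ## The group `X` of characters -/

/-- The group `X` of (continuous, unitary) characters of `𝔊`, written multiplicatively. -/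
abbrev Dual (p : ℕ) : Type := PontryaginDual (Multiplicative (VilenkinGroup p))

/-- The value `(χ, x)` of a character at an element of the group. -/
def value (χ : Dual p) (x : VilenkinGroup p) : Circle := χ (Multiplicative.ofAdd x)

/-- The annihilator `𝔊_n^⊥`. -/
def annih (p : ℕ) (n : ℤ) : Subgroup (Dual p) where
  carrier := {χ | ∀ x ∈ chain p n, value χ x = 1}
  one_mem' := fun _ _ => rfl
  mul_mem' := fun {χ ψ} hχ hψ x hx => by
    change value χ x * value ψ x = 1
    rw [hχ x hx, hψ x hx, one_mul]
  inv_mem' := fun {χ} hχ x hx => by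
    change (value χ x)⁻¹ = 1
    rw [hχ x hx, inv_one]

/-- The coset `𝔊_n^⊥ ζ`. -/
def coset (n : ℤ) (ζ : Dual p) : Set (Dual p) := {χ | ∃ γ ∈ annih p n, χ = γ * ζ}

theorem continuous_toCircle_coord [NeZero p] (n : ℤ) :
    Continuous fun x : VilenkinGroup p => ZMod.toCircle (coord n x) := by
  refine continuous_def.2 fun U _ => isOpen_iff_forall_mem_open.2 fun x hx => ?_
  refine ⟨_, fun y hy => ?_, isOpen_coset (n + 1) x, ?_⟩
  · have h := hy n (by omega)
    rw [map_sub, sub_eq_zero] at h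
    change ZMod.toCircle (coord n y) ∈ U
    rw [h]
    exact hx
  · intro k _
    rw [sub_self, map_zero]

/-- The Rademacher character `r_n`, with `(r_n, x) = exp (2 π i xₙ / p)`. -/
def rademacher (p : ℕ) [NeZero p] (n : ℤ) : Dual p where
  toFun x := ZMod.toCircle (coord n x.toAdd)
  map_one' := by
    change ZMod.toCircle (coord n (0 : VilenkinGroup p)) = 1
    rw [map_zero, AddChar.map_zero_eq_one]
  map_mul' x y := by
    change ZMod.toCircle (coord n (x.toAdd + y.toAdd)) = _
    rw [map_add, AddChar.map_add_eq_mul]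
  continuous_toFun := continuous_toCircle_coord n

/-- The character `χ𝓐`, with `(χ𝓐, x) = (χ, 𝓐x)`, as an automorphism of `X`; its inverse is
`χ ↦ χ𝓐⁻¹`. -/
def dualDilation (p : ℕ) : Dual p ≃* Dual p where
  toFun χ := PontryaginDual.map
    ⟨AddMonoidHom.toMultiplicative (dilation p).toAddMonoidHom, continuous_dilation⟩ χ
  invFun χ := PontryaginDual.map
    ⟨AddMonoidHom.toMultiplicative (dilation p).symm.toAddMonoidHom, continuous_dilation_symm⟩ χ
  left_inv χ := PontryaginDual.ext fun x => congrArg χ ((dilation p).apply_symm_apply x.toAdd)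
  right_inv χ := PontryaginDual.ext fun x => congrArg χ ((dilation p).symm_apply_apply x.toAdd)
  map_mul' _ _ := rfl

/-- The character `r_a^{d 0} r_{a+1}^{d 1} ⋯ r_{a+k-1}^{d (k-1)}`. -/
def word [NeZero p] (a : ℤ) {k : ℕ} (d : Fin k → Fin p) : Dual p :=
  ∏ i : Fin k, rademacher p (a + i) ^ (d i : ℕ)

/-! ## Step functions, elementary sets and elementary masks -/

/-- The class `𝔇_{-N}(𝔊_M^⊥)`: functions on `X` supported in `𝔊_M^⊥` and constant on the cosets of
`𝔊_{-N}^⊥`. Such a function takes finitely many values, on compact open sets, so that it is a step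
function in `L²(X)`. -/
def IsStep (N M : ℕ) (f : Dual p → ℂ) : Prop :=
  (∀ χ, f χ ≠ 0 → χ ∈ annih p M) ∧ ∀ χ, ∀ γ ∈ annih p (-N), f (γ * χ) = f χ

/-- `(N,M)`-elementary sets. The digits `α = (α_{-N}, …, α_{-1})` enumerate the indices `j`, and
`η α` is the tuple `(α_0, …, α_{M-1})` that goes with `j`. -/
def IsElementarySet [NeZero p] (N M : ℕ) (E : Set (Dual p)) : Prop :=
  ∃ η : (Fin N → Fin p) → (Fin M → Fin p),
    E = ⋃ α, coset (-N) (word (-N) α * word 0 (η α)) ∧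
    (Pairwise fun α β => Disjoint (coset (-N) (word (-N) α * word 0 (η α)))
      (coset (-N) (word (-N) β * word 0 (η β)))) ∧
    (Pairwise fun α β : Fin N → Fin p =>
      Disjoint (coset (-N) (word (-N) α)) (coset (-N) (word (-N) β))) ∧
    (⋃ α : Fin N → Fin p, coset (-N) (word (-N) α)) = (annih p 0 : Set (Dual p)) ∧
    coset (-N) (word (-N) (0 : Fin N → Fin p) * word 0 (η 0)) = (annih p (-N) : Set (Dual p)) ∧
    ∀ l < M + N, (((annih p (-N + l + 1) : Set (Dual p)) \ annih p (-N + l)) ∩ E).Nonempty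

/-- The element `a_{-1} g_{-1} + ⋯ + a_{-s} g_{-s}`. These form `H_0^{(s)}`, each occurring for
exactly one tuple of digits. -/
def shiftElt {s : ℕ} (a : Fin s → Fin p) : VilenkinGroup p :=
  ∑ j : Fin s, (a j : ℕ) • basicElt p (-(j + 1))

/-- `m` is the mask `m(χ) = (1/p) ∑_{h ∈ H_0^{(N+1)}} β_h \overline{(χ𝓐⁻¹, h)}` of a refinement
equation with some coefficients `β_h`. -/
def IsMask (N : ℕ) (m : Dual p → ℂ) : Prop :=
  ∃ β : VilenkinGroup p → ℂ, ∀ χ, m χ = 1 / (p : ℂ) * ∑ a : Fin (N + 1) → Fin p,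
    β (shiftElt a) * (starRingEnd ℂ) (value ((dualDilation p).symm χ) (shiftElt a) : ℂ)

/-- `N`-elementary masks. -/
def IsElementaryMask (N : ℕ) (m : Dual p → ℂ) : Prop :=
  IsMask N m ∧ (∀ χ, ∀ γ ∈ annih p (-N), m (γ * χ) = m χ) ∧
    (∀ χ, ‖m χ‖ = 0 ∨ ‖m χ‖ = 1) ∧ ∀ γ ∈ annih p (-N), m γ = 1

/-! ## Trees -/

/-- A finite rooted tree with vertices labelled by elements of `{0, …, p-1}`. -/
structure LabelledTree (p : ℕ) where
  Vertex : Type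
  finite : Finite Vertex
  graph : SimpleGraph Vertex
  isTree : graph.IsTree
  root : Vertex
  label : Vertex → Fin p

namespace LabelledTree

variable (T : LabelledTree p)

/-- The level of a vertex: its distance to the root. -/
def level (v : T.Vertex) : ℕ := T.graph.dist T.root v

/-- `w` is a child of `v`. -/
def IsChild (v w : T.Vertex) : Prop := T.graph.Adj v w ∧ T.level w = T.level v + 1

/-- A path with `k` vertices `c 0 → c 1 → ⋯ → c (k-1)`, directed away from the root. -/
def IsPath {k : ℕ} (c : Fin k → T.Vertex) : Prop :=
  ∀ (i : ℕ) (h : i + 1 < k), T.IsChild (c ⟨i, Nat.lt_of_succ_lt h⟩) (c ⟨i + 1, h⟩)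

/-- The height: the number of levels, that is the number of vertices of a longest path. -/
def height : ℕ := sSup (Set.range fun v => T.level v + 1)

/-- `N`-valid trees: all vertices of the levels `0, 1, …, N-1` have label zero, and each path of
`N` labels is present exactly once. -/
def IsValid [NeZero p] (N : ℕ) : Prop :=
  (∀ v, T.level v < N → T.label v = 0) ∧
    ∀ α : Fin N → Fin p, ∃! c : Fin N → T.Vertex, T.IsPath c ∧ ∀ i, T.label (c i) = α i

/-- The set `Ẽ`: the union, over the paths `c 0 → ⋯ → c (s+N)` of the tree that start with `N` zeros
and over the vertices `c q` of such a path, of the cosets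
`𝔊_{-N}^⊥ r_{-N}^{label (c q)} r_{-N+1}^{label (c (q-1))} ⋯`, where one reads the path
backwards from `c q`, over `N+1` vertices, or down to `c 0` if this comes first (`q < N`). -/
def tilde [NeZero p] (N : ℕ) : Set (Dual p) :=
  {χ | ∃ (s : ℕ) (c : Fin (s + N + 1) → T.Vertex), T.IsPath c ∧
    (∀ i : Fin (s + N + 1), (i : ℕ) < N → T.label (c i) = 0) ∧ ∃ q : Fin (s + N + 1),
      χ ∈ coset (-N) (word (-N) fun i : Fin (min (q : ℕ) N + 1) =>
        T.label (c ⟨(q : ℕ) - i, lt_of_le_of_lt (Nat.sub_le _ _) q.2⟩))}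

end LabelledTree

/-- The periodic extension `S_X = ⋃_{s ≥ 1} ⋃_{α_1, …, α_s} S r_1^{α_1} ⋯ r_s^{α_s}`. -/
def periodicExtension [NeZero p] (S : Set (Dual p)) : Set (Dual p) :=
  {χ | ∃ s : ℕ, 1 ≤ s ∧ ∃ α : Fin s → Fin p, ∃ ψ ∈ S, χ = ψ * word 1 α}

/-- The tree generates the set `E`: `E = ⋂_{n ≥ 0} Ẽ_X 𝓐ⁿ`. -/
def LabelledTree.Generates [NeZero p] (T : LabelledTree p) (N : ℕ) (E : Set (Dual p)) : Prop :=
  E = ⋂ n : ℕ, (dualDilation p)^[n] '' periodicExtension (T.tilde N)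

end Vilenkin

end

noncomputable section

namespace Vilenkin

section

variable {p : ℕ}

/-! ## Characters and their digits -/

/-! A character is recorded by its digits, the exponents of the `r_k`; almost all digits of large
index vanish, and a coset of 𝔊_{-N}^⊥ is given by the digits from index -N on (`mem_coset_iff`). The
map χ ↦ χ𝓐⁻¹ moves every digit down by one index.

Call the digits with indices -N, …, -1 the state of χ. Each state occurs in `E`, and there it
determines all later digits; so on `E` the digit at 0 is a function f of the state. The refinement
equation says that χ ∈ E iff m₀(χ) ≠ 0 and χ𝓐⁻¹ ∈ E. Hence `E` is stable under χ ↦ χ𝓐⁻¹, which acts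
on states as the shift register with feedback f (`state_iterate_dualDilation_symm`). Since E ⊂
𝔊_M^⊥, the register is empty after M + N steps, and the outermost shell that `E` meets shows that
fewer steps do not suffice.

A register that always empties is a tree: the parent of a nonzero state is its successor, and a
chain of N zero vertices, beginning at the root, represents the zero state. The label is the first
digit, so N labels read towards the root spell a state and the next one is its feedback. This gives
validity, the height (M + N) + N, and the description of `Ẽ` in `mem_stateTree_tilde`.

Finally m₀ sees only the digits -N, …, 0, and m₀(χ) ≠ 0 exactly when the digit at 0 is f of the
state (`mask_ne_zero_iff`). So the periodic extension of `Ẽ` is the support of m₀, and unrolling the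
refinement equation gives `E` as the intersection (`mem_iff_forall_mask_ne_zero`). -/

theorem coord_basicElt (k n : ℤ) : coord k (basicElt p n) = if k = n then 1 else 0 :=
  Pi.single_apply n (1 : ZMod p) k

theorem ext_coord {x y : VilenkinGroup p} (h : ∀ k, coord k x = coord k y) : x = y :=
  Subtype.ext (funext h)

theorem value_add (χ : Dual p) (x y : VilenkinGroup p) :
    value χ (x + y) = value χ x * value χ y := map_mul χ _ _

theorem value_zero (χ : Dual p) : value χ 0 = 1 := map_one χ

theorem value_nsmul (χ : Dual p) (n : ℕ) (x : VilenkinGroup p) :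
    value χ (n • x) = value χ x ^ n := map_pow χ _ n

theorem value_mul (χ ψ : Dual p) (x : VilenkinGroup p) :
    value (χ * ψ) x = value χ x * value ψ x := rfl

theorem nsmul_self_eq_zero (x : VilenkinGroup p) : p • x = 0 :=
  ext_coord fun k => by rw [map_nsmul, map_zero, nsmul_eq_mul, CharP.cast_eq_zero, zero_mul]

theorem value_pow_self (χ : Dual p) (x : VilenkinGroup p) : value χ x ^ p = 1 := by
  rw [← value_nsmul, nsmul_self_eq_zero, value_zero]

theorem exists_chain_subset {U : Set (VilenkinGroup p)} (hU : IsOpen U) :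
    ∀ x ∈ U, ∃ n : ℤ, ∀ y, y - x ∈ chain p n → y ∈ U := by
  induction hU with
  | basic s hs =>
    obtain ⟨n, g, rfl⟩ := hs
    intro x hx
    refine ⟨n, fun y hy => ?_⟩
    have := (chain p n).add_mem hy hx
    rwa [sub_add_sub_cancel] at this
  | univ => exact fun x _ => ⟨0, fun _ _ => trivial⟩
  | inter s t _ _ hs ht =>
    rintro x ⟨hxs, hxt⟩
    obtain ⟨m, hm⟩ := hs x hxs
    obtain ⟨n, hn⟩ := ht x hxt
    refine ⟨max m n, fun y hy => ⟨hm y fun k hk => hy k ?_, hn y fun k hk => hy k ?_⟩⟩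
    · exact lt_of_lt_of_le hk (le_max_left _ _)
    · exact lt_of_lt_of_le hk (le_max_right _ _)
  | sUnion S _ hS =>
    rintro x ⟨s, hs, hx⟩
    obtain ⟨n, hn⟩ := hS s hs x hx
    exact ⟨n, fun y hy => ⟨s, hs, hn y hy⟩⟩

theorem annih_mono {m n : ℤ} (h : m ≤ n) : annih p m ≤ annih p n :=
  fun _ hχ x hx => hχ x fun k hk => hx k (lt_of_lt_of_le hk h)

theorem basicElt_mem_chain {n k : ℤ} (h : n ≤ k) : basicElt p k ∈ chain p n := fun j hj => by
  rw [coord_basicElt, if_neg (by omega)]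

theorem dilation_symm_basicElt (k : ℤ) : (dilation p).symm (basicElt p k) = basicElt p (k + 1) :=
  ext_coord fun j => by
    rw [coord_dilation_symm, coord_basicElt, coord_basicElt]
    simp only [sub_eq_iff_eq_add]

theorem value_dualDilation_symm (χ : Dual p) (x : VilenkinGroup p) :
    value ((dualDilation p).symm χ) x = value χ ((dilation p).symm x) := rfl

theorem mem_image_iterate_dualDilation {S : Set (Dual p)} {n : ℕ} {χ : Dual p} :
    χ ∈ (dualDilation p)^[n] '' S ↔ (dualDilation p).symm^[n] χ ∈ S := by
  have hl : Function.LeftInverse (dualDilation p).symm^[n] (dualDilation p)^[n] :=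
    Function.LeftInverse.iterate (dualDilation p).symm_apply_apply n
  have hr : Function.RightInverse (dualDilation p).symm^[n] (dualDilation p)^[n] :=
    Function.LeftInverse.iterate (dualDilation p).apply_symm_apply n
  constructor
  · rintro ⟨ψ, hψ, rfl⟩
    rwa [hl ψ]
  · intro h
    exact ⟨_, h, hr χ⟩

variable [NeZero p]

theorem exists_toCircle_eq {z : Circle} (hz : z ^ p = 1) : ∃ c : ZMod p, ZMod.toCircle c = z := by
  have h1 : (z : ℂ) ^ p = 1 := by
    have := congrArg (fun w : Circle => (w : ℂ)) hz
    simpa using this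
  obtain ⟨i, -, hi⟩ := (Complex.isPrimitiveRoot_exp p (NeZero.ne p)).eq_pow_of_pow_eq_one h1
  refine ⟨(i : ZMod p), Circle.ext ?_⟩
  rw [ZMod.toCircle_natCast, ← hi, ← Complex.exp_nat_mul]
  congr 1
  ring

/-- Every character is trivial on some subgroup of the chain. -/
theorem exists_mem_annih (χ : Dual p) : ∃ n : ℤ, χ ∈ annih p n := by
  -- All values are p-th roots of unity, so the values other than 1 lie in a finite, hence closed,
  -- set; avoiding it is an open condition that holds at 0.
  have hF : (Set.range (ZMod.toCircle : ZMod p → Circle) \ {1}).Finite :=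
    (Set.finite_range _).subset Set.sdiff_subset
  have hO : IsOpen ((fun x : VilenkinGroup p => value χ x) ⁻¹'
      (Set.range (ZMod.toCircle : ZMod p → Circle) \ {1})ᶜ) :=
    hF.isClosed.isOpen_compl.preimage (map_continuous χ)
  obtain ⟨n, hn⟩ := exists_chain_subset hO 0 (by simp [value_zero])
  refine ⟨n, fun x hx => ?_⟩
  have h := hn x (by rwa [sub_zero])
  by_contra h1
  exact h ⟨exists_toCircle_eq (value_pow_self χ x), h1⟩

theorem exists_digit (χ : Dual p) (k : ℤ) :
    ∃ c : ZMod p, ZMod.toCircle c = value χ (basicElt p k) :=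
  exists_toCircle_eq (value_pow_self χ _)

/-- The exponent of `r_k` in the expansion of a character. -/
def digit (χ : Dual p) (k : ℤ) : ZMod p := (exists_digit χ k).choose

theorem toCircle_digit (χ : Dual p) (k : ℤ) :
    ZMod.toCircle (digit χ k) = value χ (basicElt p k) := (exists_digit χ k).choose_spec

theorem digit_eq_iff {χ : Dual p} {k : ℤ} {c : ZMod p} :
    digit χ k = c ↔ value χ (basicElt p k) = ZMod.toCircle c := by
  rw [← toCircle_digit, ZMod.injective_toCircle.eq_iff]

theorem digit_one (k : ℤ) : digit (1 : Dual p) k = 0 := by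
  rw [digit_eq_iff, AddChar.map_zero_eq_one]; rfl

theorem digit_mul (χ ψ : Dual p) (k : ℤ) : digit (χ * ψ) k = digit χ k + digit ψ k := by
  rw [digit_eq_iff, AddChar.map_add_eq_mul, toCircle_digit, toCircle_digit, value_mul]

theorem digit_inv (χ : Dual p) (k : ℤ) : digit χ⁻¹ k = -digit χ k := by
  rw [eq_neg_iff_add_eq_zero, ← digit_mul, inv_mul_cancel, digit_one]

theorem digit_pow (χ : Dual p) (n : ℕ) (k : ℤ) : digit (χ ^ n) k = n * digit χ k := by
  induction n with
  | zero => simp [digit_one]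
  | succ n ih => rw [pow_succ, digit_mul, ih]; push_cast; ring

theorem digit_prod {ι : Type*} (s : Finset ι) (f : ι → Dual p) (k : ℤ) :
    digit (∏ i ∈ s, f i) k = ∑ i ∈ s, digit (f i) k := by
  classical
  induction s using Finset.induction_on with
  | empty => simp [digit_one]
  | insert a s ha ih => rw [Finset.prod_insert ha, Finset.sum_insert ha, digit_mul, ih]

theorem digit_rademacher (n k : ℤ) : digit (rademacher p n) k = if k = n then 1 else 0 := by
  rw [digit_eq_iff]
  change ZMod.toCircle (coord n (basicElt p k)) = _
  simp only [coord_basicElt, eq_comm]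

theorem digit_word_apply (a : ℤ) {n : ℕ} (d : Fin n → Fin p) (i : Fin n) :
    digit (word a d) (a + i) = ((d i : ℕ) : ZMod p) := by
  rw [word, digit_prod, Finset.sum_eq_single i]
  · rw [digit_pow, digit_rademacher, if_pos rfl, mul_one]
  · intro j _ hj
    rw [digit_pow, digit_rademacher, if_neg, mul_zero]
    intro h
    exact hj (Fin.ext (by omega))
  · simp

theorem digit_word_of_lt {a k : ℤ} {n : ℕ} (d : Fin n → Fin p) (hk : k < a) :
    digit (word a d) k = 0 := by
  rw [word, digit_prod]
  refine Finset.sum_eq_zero fun j _ => ?_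
  rw [digit_pow, digit_rademacher, if_neg (by omega), mul_zero]

theorem digit_word_of_ge {a k : ℤ} {n : ℕ} (d : Fin n → Fin p) (hk : a + n ≤ k) :
    digit (word a d) k = 0 := by
  rw [word, digit_prod]
  refine Finset.sum_eq_zero fun j _ => ?_
  rw [digit_pow, digit_rademacher, if_neg (by omega), mul_zero]

/-- An element of 𝔊_n differs from a multiple of g_n by an element of 𝔊_{n+1}. -/
theorem mem_annih_of_mem_succ {χ : Dual p} {n : ℤ} (h : χ ∈ annih p (n + 1))
    (h0 : digit χ n = 0) : χ ∈ annih p n := by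
  intro x hx
  have hy : x - (coord n x).val • basicElt p n ∈ chain p (n + 1) := by
    intro k hk
    rw [map_sub, map_nsmul, coord_basicElt]
    rcases lt_or_eq_of_le (Int.lt_add_one_iff.1 hk) with hk | rfl
    · rw [hx k hk, if_neg hk.ne]; simp
    · simp
  rw [← sub_add_cancel x ((coord n x).val • basicElt p n), value_add, h _ hy, value_nsmul,
    digit_eq_iff.1 h0, AddChar.map_zero_eq_one, one_pow, one_mul]

/-- The character is trivial on some 𝔊_K; vanishing digits then allow a descent from K to n, one
index at a time. -/
theorem mem_annih_iff {χ : Dual p} {n : ℤ} : χ ∈ annih p n ↔ ∀ k, n ≤ k → digit χ k = 0 := by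
  constructor
  · intro h k hk
    rw [digit_eq_iff, h _ (basicElt_mem_chain hk), AddChar.map_zero_eq_one]
  · intro h
    obtain ⟨K, hK⟩ := exists_mem_annih χ
    have key : ∀ j : ℕ, χ ∈ annih p (n + j) → χ ∈ annih p n := by
      intro j
      induction j with
      | zero => intro hj; simpa using hj
      | succ j ih =>
        intro hj
        refine ih (mem_annih_of_mem_succ ?_ (h _ (by omega)))
        push_cast at hj
        rwa [add_assoc]
    exact key (K - n).toNat (annih_mono (by omega) hK)

theorem mem_coset_iff {χ ζ : Dual p} {n : ℤ} :
    χ ∈ coset n ζ ↔ ∀ k, n ≤ k → digit χ k = digit ζ k := by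
  constructor
  · rintro ⟨γ, hγ, rfl⟩ k hk
    rw [digit_mul, mem_annih_iff.1 hγ k hk, zero_add]
  · intro h
    refine ⟨χ * ζ⁻¹, mem_annih_iff.2 fun k hk => ?_, by rw [inv_mul_cancel_right]⟩
    rw [digit_mul, digit_inv, h k hk, add_neg_cancel]

theorem digit_dualDilation_symm (χ : Dual p) (k : ℤ) :
    digit ((dualDilation p).symm χ) k = digit χ (k + 1) := by
  rw [digit_eq_iff, value_dualDilation_symm, dilation_symm_basicElt, toCircle_digit]

theorem digit_dualDilation (χ : Dual p) (k : ℤ) :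
    digit (dualDilation p χ) k = digit χ (k - 1) := by
  rw [← (dualDilation p).symm_apply_apply χ, digit_dualDilation_symm, sub_add_cancel,
    MulEquiv.symm_apply_apply]

theorem digit_iterate_dualDilation_symm (n : ℕ) (χ : Dual p) (k : ℤ) :
    digit ((dualDilation p).symm^[n] χ) k = digit χ (k + n) := by
  induction n generalizing χ with
  | zero => simp
  | succ n ih =>
    rw [Function.iterate_succ_apply, ih, digit_dualDilation_symm]
    push_cast
    congr 1
    ring

theorem value_sum_basicElt {ι : Type*} (s : Finset ι) (c : ι → ℕ) (k : ι → ℤ) (χ : Dual p) :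
    value χ (∑ i ∈ s, c i • basicElt p (k i)) = ∏ i ∈ s, ZMod.toCircle (digit χ (k i)) ^ c i := by
  classical
  induction s using Finset.induction_on with
  | empty => exact value_zero χ
  | insert a s ha ih =>
    rw [Finset.sum_insert ha, Finset.prod_insert ha, value_add, ih, value_nsmul, toCircle_digit]

/-- A mask depends on the digits with the indices `-N, …, 0` only. -/
theorem IsMask.congr {N : ℕ} {m : Dual p → ℂ} (hm : IsMask N m) {χ ψ : Dual p}
    (h : ∀ k : ℤ, -N ≤ k → k ≤ 0 → digit χ k = digit ψ k) : m χ = m ψ := by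
  obtain ⟨β, hβ⟩ := hm
  rw [hβ, hβ]
  congr 1
  refine Finset.sum_congr rfl fun a _ => ?_
  have hv : value ((dualDilation p).symm χ) (shiftElt a) =
      value ((dualDilation p).symm ψ) (shiftElt a) := by
    -- The value of χ𝓐⁻¹ at g_{-(j+1)} is given by the digit of χ at -j, and 0 ≤ j ≤ N.
    rw [shiftElt, value_sum_basicElt, value_sum_basicElt]
    refine Finset.prod_congr rfl fun j _ => ?_
    rw [digit_dualDilation_symm, digit_dualDilation_symm, h _ (by omega) (by omega)]
  rw [hv]

/-- The residue as an element of `{0, …, p-1}`. -/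
def toFin (x : ZMod p) : Fin p := ⟨x.val, ZMod.val_lt x⟩

theorem natCast_toFin (x : ZMod p) : ((toFin x : ℕ) : ZMod p) = x := ZMod.natCast_zmod_val x

theorem toFin_natCast (i : Fin p) : toFin ((i : ℕ) : ZMod p) = i :=
  Fin.ext (ZMod.val_cast_of_lt i.2)

theorem toFin_eq_iff {x : ZMod p} {i : Fin p} : toFin x = i ↔ x = ((i : ℕ) : ZMod p) :=
  ⟨fun h => by rw [← h, natCast_toFin], fun h => by rw [h, toFin_natCast]⟩

theorem toFin_eq_zero_iff {x : ZMod p} : toFin x = 0 ↔ x = 0 := by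
  rw [toFin_eq_iff, Fin.val_zero, Nat.cast_zero]

end

/-! ## Trees given by a parent function -/

section ParentTree

variable {W : Type} {par : W → W} {root : W} {lvl : W → ℕ}

/-- The graph in which every vertex is joined with its parent. -/
def parentGraph (par : W → W) : SimpleGraph W := SimpleGraph.fromRel fun v w => par v = w

theorem parentGraph_adj {v w : W} : (parentGraph par).Adj v w ↔ v ≠ w ∧ (par v = w ∨ par w = v) :=
  Iff.rfl

theorem exists_walk_root (hlvl : ∀ v, v ≠ root → lvl v = lvl (par v) + 1) :
    ∀ (n : ℕ) (v : W), lvl v = n → ∃ q : (parentGraph par).Walk root v, q.length ≤ n := by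
  intro n
  induction n with
  | zero =>
    intro v hv
    obtain rfl : v = root := by
      by_contra h
      have := hlvl v h
      omega
    exact ⟨.nil, le_rfl⟩
  | succ n ih =>
    intro v hv
    by_cases h : v = root
    · subst h
      exact ⟨.nil, Nat.zero_le _⟩
    · have h1 := hlvl v h
      obtain ⟨q, hq⟩ := ih (par v) (by omega)
      have hadj : (parentGraph par).Adj (par v) v :=
        parentGraph_adj.2 ⟨fun he => by rw [he] at h1; omega, Or.inr rfl⟩
      exact ⟨q.concat hadj, by rw [SimpleGraph.Walk.length_concat]; omega⟩

theorem lvl_le_add_length (hroot : par root = root)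
    (hlvl : ∀ v, v ≠ root → lvl v = lvl (par v) + 1) {v w : W} (q : (parentGraph par).Walk v w) :
    lvl w ≤ lvl v + q.length := by
  induction q with
  | nil => simp
  | @cons a b c hab q ih =>
    have hab' : lvl b ≤ lvl a + 1 := by
      obtain ⟨-, h | h⟩ := parentGraph_adj.1 hab
      · by_cases ha : a = root
        · subst ha; rw [← h, hroot]; omega
        · have := hlvl a ha; rw [h] at this; omega
      · by_cases hb : b = root
        · subst hb; rw [← h, hroot]; omega
        · have := hlvl b hb; rw [h] at this; omega
    rw [SimpleGraph.Walk.length_cons]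
    omega

theorem parentGraph_connected (hlvl : ∀ v, v ≠ root → lvl v = lvl (par v) + 1) :
    (parentGraph par).Connected := by
  have hr : ∀ v, (parentGraph par).Reachable root v := fun v => by
    obtain ⟨q, -⟩ := exists_walk_root hlvl _ v rfl
    exact ⟨q⟩
  have : Nonempty W := ⟨root⟩
  exact ⟨fun v w => (hr v).symm.trans (hr w)⟩

theorem parentGraph_dist (hroot : par root = root) (h0 : lvl root = 0)
    (hlvl : ∀ v, v ≠ root → lvl v = lvl (par v) + 1) (v : W) :
    (parentGraph par).dist root v = lvl v := by
  refine le_antisymm ?_ ?_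
  · obtain ⟨q, hq⟩ := exists_walk_root hlvl _ v rfl
    exact (SimpleGraph.dist_le q).trans hq
  · obtain ⟨q, hq⟩ := (parentGraph_connected hlvl root v).exists_walk_length_eq_dist
    have := lvl_le_add_length hroot hlvl q
    omega

/-- Edges are counted by v ↦ {v, par v} on the vertices other than the root. Two vertices cannot be
parents of each other, as each level would exceed the other. -/
theorem parentGraph_isTree [Finite W] (hroot : par root = root)
    (hlvl : ∀ v, v ≠ root → lvl v = lvl (par v) + 1) : (parentGraph par).IsTree := by
  classical
  rw [SimpleGraph.isTree_iff_connected_and_card]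
  refine ⟨parentGraph_connected hlvl, ?_⟩
  have hadj : ∀ v, v ≠ root → (parentGraph par).Adj v (par v) := fun v hv =>
    parentGraph_adj.2 ⟨fun he => by have := hlvl v hv; rw [← he] at this; omega, Or.inl rfl⟩
  let F : {v : W // v ≠ root} → (parentGraph par).edgeSet := fun v => ⟨s(v.1, par v.1), hadj v.1 v.2⟩
  have hF : Function.Bijective F := by
    constructor
    · rintro ⟨v, hv⟩ ⟨w, hw⟩ h
      have h' : s(v, par v) = s(w, par w) := congrArg Subtype.val h
      rcases Sym2.eq_iff.1 h' with ⟨h1, -⟩ | ⟨h1, h2⟩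
      · exact Subtype.ext h1
      · have a := hlvl v hv
        have b := hlvl w hw
        rw [h2] at a
        rw [← h1] at b
        omega
    · rintro ⟨e, he⟩
      induction e using Sym2.ind with
      | _ v w =>
        obtain ⟨hne, h | h⟩ := parentGraph_adj.1 he
        · have hv : v ≠ root := by rintro rfl; exact hne (by rw [← h, hroot])
          exact ⟨⟨v, hv⟩, Subtype.ext (congrArg (fun u => s(v, u)) h)⟩
        · have hw : w ≠ root := by rintro rfl; exact hne (by rw [← h, hroot])
          exact ⟨⟨w, hw⟩, Subtype.ext ((congrArg (fun u => s(w, u)) h).trans Sym2.eq_swap)⟩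
  have : Fintype W := Fintype.ofFinite W
  rw [← Nat.card_congr (Equiv.ofBijective F hF), Nat.card_eq_fintype_card,
    Nat.card_eq_fintype_card, Fintype.card_subtype_compl, Fintype.card_subtype_eq]
  have : 0 < Fintype.card W := Fintype.card_pos_iff.2 ⟨root⟩
  omega

end ParentTree

/-! ## Shift registers -/

section Register

variable {A : Type*} {N : ℕ}

/-- One step of the shift register with the feedback function `f`. -/
def shift (f : (Fin N → A) → A) (α : Fin N → A) : Fin N → A :=
  fun i => if h : (i : ℕ) + 1 < N then α ⟨i + 1, h⟩ else f α

theorem iterate_shift_apply (f : (Fin N → A) → A) (n : ℕ) (α : Fin N → A) (j : Fin N)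
    (h : n + j < N) : (shift f)^[n] α j = α ⟨n + j, h⟩ := by
  induction n generalizing j with
  | zero => simp
  | succ n ih =>
    rw [Function.iterate_succ_apply', shift, dif_pos (show (j : ℕ) + 1 < N by omega),
      ih ⟨j + 1, by omega⟩ (by simp only; omega)]
    congr 2
    simp only
    omega

/-- The entry fed in at the first step moves to the front in the remaining N - 1 steps. Hence N + 1
successive labels spell a state and its feedback. -/
theorem iterate_shift_head (f : (Fin N → A) → A) (hN : 0 < N) (α : Fin N → A) :
    (shift f)^[N] α ⟨0, hN⟩ = f α := by
  obtain ⟨n, rfl⟩ : ∃ n, N = n + 1 := ⟨N - 1, by omega⟩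
  rw [Function.iterate_succ_apply, iterate_shift_apply _ _ _ _ (by simp only; omega), shift,
    dif_neg (by simp only; omega)]

variable [Zero A]

theorem shift_zero {f : (Fin N → A) → A} (hf : f 0 = 0) : shift f 0 = 0 := by
  funext i
  simp [shift, hf]

/-- The number of steps after which the register is empty. -/
def steps (f : (Fin N → A) → A) (α : Fin N → A) : ℕ := sInf {n | (shift f)^[n] α = 0}

theorem steps_zero (f : (Fin N → A) → A) : steps f 0 = 0 :=
  Nat.eq_zero_of_le_zero (Nat.sInf_le rfl)

theorem steps_le {f : (Fin N → A) → A} {α : Fin N → A} {n : ℕ} (h : (shift f)^[n] α = 0) :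
    steps f α ≤ n := Nat.sInf_le h

theorem iterate_shift_eq_zero {f : (Fin N → A) → A} (hf : f 0 = 0) {α : Fin N → A} {n : ℕ}
    (h : ∃ m, (shift f)^[m] α = 0) (hn : steps f α ≤ n) : (shift f)^[n] α = 0 := by
  have h1 : (shift f)^[steps f α] α = 0 := Nat.sInf_mem h
  obtain ⟨k, rfl⟩ := Nat.exists_eq_add_of_le' hn
  rw [Function.iterate_add_apply, h1, Function.iterate_fixed (shift_zero hf)]

theorem steps_eq_succ {f : (Fin N → A) → A} (hf : f 0 = 0)
    (h : ∀ α, ∃ m, (shift f)^[m] α = 0) {α : Fin N → A} (hα : α ≠ 0) :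
    steps f α = steps f (shift f α) + 1 := by
  refine le_antisymm (steps_le ?_) ?_
  · rw [Function.iterate_succ_apply]
    exact iterate_shift_eq_zero hf (h _) le_rfl
  · have h0 := iterate_shift_eq_zero hf (h α) le_rfl
    cases hs : steps f α with
    | zero => rw [hs] at h0; exact absurd h0 hα
    | succ n =>
      rw [hs, Function.iterate_succ_apply] at h0
      exact Nat.succ_le_succ (steps_le h0)

/-- The states of the register, the zero state being preceded by a chain of `N - 1` more
vertices. -/
abbrev StateVertex (A : Type*) [Zero A] (N : ℕ) : Type _ :=
  {v : (Fin N → A) × Fin N // v.1 ≠ 0 → (v.2 : ℕ) + 1 = N}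

namespace StateVertex

open Classical in
/-- The next state, or the preceding vertex of the chain. -/
def parent (f : (Fin N → A) → A) (v : StateVertex A N) : StateVertex A N :=
  if h : v.1.1 = 0 then ⟨(0, ⟨v.1.2 - 1, lt_of_le_of_lt (Nat.sub_le _ _) v.1.2.2⟩),
    fun h0 => absurd rfl h0⟩
  else ⟨(shift f v.1.1, v.1.2), fun _ => v.2 h⟩

/-- The first vertex of the chain. -/
def root (A : Type*) [Zero A] {N : ℕ} (hN : 0 < N) : StateVertex A N :=
  ⟨(0, ⟨0, hN⟩), fun h0 => absurd rfl h0⟩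

/-- The distance to the first vertex of the chain. -/
def lvl (f : (Fin N → A) → A) (v : StateVertex A N) : ℕ := steps f v.1.1 + v.1.2

/-- The vertex of a state. -/
def ofState (hN : 0 < N) (α : Fin N → A) : StateVertex A N :=
  ⟨(α, ⟨N - 1, Nat.sub_lt hN one_pos⟩), fun _ => Nat.sub_add_cancel hN⟩

variable {f : (Fin N → A) → A} (hf : f 0 = 0) (hnil : ∀ α, ∃ m, (shift f)^[m] α = 0)

include hf in
theorem parent_state (v : StateVertex A N) : (parent f v).1.1 = shift f v.1.1 := by
  rw [parent]
  split_ifs with h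
  · rw [h, shift_zero hf]
  · rfl

include hf in
theorem iterate_parent_state (n : ℕ) (v : StateVertex A N) :
    ((parent f)^[n] v).1.1 = (shift f)^[n] v.1.1 := by
  induction n with
  | zero => rfl
  | succ n ih => rw [Function.iterate_succ_apply', parent_state hf, ih, Function.iterate_succ_apply']

/-- Truncated subtraction, 0 - 1 = 0, makes the root its own parent. -/
theorem parent_root (hN : 0 < N) : parent f (root A hN) = root A hN := by
  rw [parent, dif_pos (show (root A hN).1.1 = 0 from rfl)]; rfl

theorem lvl_root (hN : 0 < N) : lvl f (root A hN) = 0 := by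
  change steps f 0 + 0 = 0
  rw [steps_zero]

include hf hnil in
-- On the chain of zeros the position drops by one; at a nonzero state the position stays N - 1 and
-- the number of remaining steps drops by one.
theorem lvl_eq_succ (hN : 0 < N) (v : StateVertex A N) (hv : v ≠ root A hN) :
    lvl f v = lvl f (parent f v) + 1 := by
  obtain ⟨⟨α, j⟩, hj⟩ := v
  by_cases h : α = 0
  · subst h
    have : (j : ℕ) ≠ 0 := fun h0 => hv (Subtype.ext (Prod.ext rfl (Fin.ext h0)))
    simp only [lvl, parent, dite_true, steps_zero]
    omega
  · simp only [lvl, parent, h, dite_false, steps_eq_succ hf hnil h]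
    omega

include hf hnil in
theorem lvl_iterate_parent (hN : 0 < N) (n : ℕ) (v : StateVertex A N) :
    lvl f ((parent f)^[n] v) = lvl f v - n := by
  induction n with
  | zero => rfl
  | succ n ih =>
    rw [Function.iterate_succ_apply']
    by_cases h : (parent f)^[n] v = root A hN
    · rw [h, lvl_root] at ih
      rw [h, parent_root, lvl_root]
      omega
    · have := lvl_eq_succ hf hnil hN _ h
      omega

include hf hnil in
theorem state_eq_zero_of_lvl_lt {v : StateVertex A N} (h : lvl f v < N) : v.1.1 = 0 := by
  by_contra h0
  have h1 := v.2 h0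
  have h2 := steps_eq_succ hf hnil h0
  rw [lvl] at h
  omega

/-- Only the zero state has several vertices, and all but the last of them lie below level N - 1.
This yields the uniqueness of paths with N given labels. -/
theorem eq_ofState_of_le_lvl (hN : 0 < N) {v : StateVertex A N} (h : N ≤ lvl f v + 1) :
    v = ofState hN v.1.1 := by
  obtain ⟨⟨α, j⟩, hj⟩ := v
  refine Subtype.ext (Prod.ext rfl (Fin.ext ?_))
  change (j : ℕ) = N - 1
  by_cases h0 : α = 0
  · subst h0
    rw [lvl, steps_zero] at h
    simp only at h
    omega
  · have := hj h0
    simp only at this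
    omega

theorem lvl_ofState (hN : 0 < N) (α : Fin N → A) : lvl f (ofState hN α) = steps f α + (N - 1) := rfl

theorem lvl_lt (v : StateVertex A N) : lvl f v < steps f v.1.1 + N :=
  Nat.add_lt_add_left v.1.2.2 _

end StateVertex

end Register

/-! ## The tree of a shift register -/

section StateTree

open StateVertex

variable {p N : ℕ} [NeZero p]

/-- The tree in which the children of a state are its predecessors in the shift register. -/
def stateTree (hN : 0 < N) (f : (Fin N → ZMod p) → ZMod p) (hf : f 0 = 0)
    (hnil : ∀ α, ∃ m, (shift f)^[m] α = 0) : LabelledTree p where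
  Vertex := StateVertex (ZMod p) N
  finite := inferInstance
  graph := parentGraph (parent f)
  isTree := parentGraph_isTree (parent_root hN) (lvl_eq_succ hf hnil hN)
  root := root _ hN
  label v := toFin (v.1.1 ⟨0, hN⟩)

variable {hN : 0 < N} {f : (Fin N → ZMod p) → ZMod p} {hf : f 0 = 0}
  {hnil : ∀ α, ∃ m, (shift f)^[m] α = 0}

theorem stateTree_level (v : StateVertex (ZMod p) N) :
    (stateTree hN f hf hnil).level v = lvl f v :=
  parentGraph_dist (parent_root hN) (lvl_root hN) (lvl_eq_succ hf hnil hN) v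

theorem stateTree_isChild {v w : StateVertex (ZMod p) N} :
    (stateTree hN f hf hnil).IsChild v w ↔ w ≠ root _ hN ∧ parent f w = v := by
  have e : (stateTree hN f hf hnil).IsChild v w ↔
      (parentGraph (parent f)).Adj v w ∧ lvl f w = lvl f v + 1 :=
    Iff.of_eq (congrArg₂ (fun a b => (parentGraph (parent f)).Adj v w ∧ a = b + 1)
      (stateTree_level w) (stateTree_level v))
  rw [e]
  constructor
  · rintro ⟨hadj, h⟩
    have hw : w ≠ root _ hN := by
      rintro rfl
      rw [lvl_root] at h
      omega
    refine ⟨hw, ?_⟩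
    obtain ⟨-, h1 | h1⟩ := parentGraph_adj.1 hadj
    · exfalso
      by_cases hv : v = root _ hN
      · subst hv
        exact hw (by rw [← h1, parent_root])
      · have := lvl_eq_succ hf hnil hN v hv
        rw [h1] at this
        omega
    · exact h1
  · rintro ⟨hw, rfl⟩
    have h := lvl_eq_succ hf hnil hN w hw
    refine ⟨parentGraph_adj.2 ⟨fun he => ?_, Or.inr rfl⟩, h⟩
    rw [he] at h
    omega

theorem IsPath.eq_iterate_parent {k : ℕ} {c : Fin k → StateVertex (ZMod p) N}
    (hc : (stateTree hN f hf hnil).IsPath c) {i j n : ℕ} (hj : j < k) (h : i + n = j) :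
    c ⟨i, by omega⟩ = (parent f)^[n] (c ⟨j, hj⟩) := by
  subst h
  induction n with
  | zero => rfl
  | succ n ih =>
    rw [ih (by omega), Function.iterate_succ_apply]
    exact congrArg _ (stateTree_isChild.1 (hc (i + n) hj)).2.symm

theorem IsPath.lvl_eq {k : ℕ} {c : Fin k → StateVertex (ZMod p) N}
    (hc : (stateTree hN f hf hnil).IsPath c) (i : ℕ) (h : i < k) :
    lvl f (c ⟨i, h⟩) = lvl f (c ⟨0, by omega⟩) + i := by
  induction i with
  | zero => rfl
  | succ i ih =>
    have h1 := stateTree_isChild.1 (hc i h)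
    rw [lvl_eq_succ hf hnil hN _ h1.1, h1.2, ih (by omega), add_assoc]

/-- The path that ends at a given vertex. -/
theorem stateTree_isPath_iterate {k : ℕ} {v : StateVertex (ZMod p) N} (hk : k ≤ lvl f v + 1) :
    (stateTree hN f hf hnil).IsPath fun i : Fin k => (parent f)^[k - 1 - i] v := by
  intro i hi
  refine stateTree_isChild.2 ⟨fun h0 => ?_, ?_⟩
  · have h1 := congrArg (lvl f) h0
    rw [lvl_iterate_parent hf hnil hN, lvl_root] at h1
    simp only at h1
    omega
  · change parent f ((parent f)^[k - 1 - (i + 1)] v) = (parent f)^[k - 1 - i] v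
    rw [← Function.iterate_succ_apply' (parent f)]
    congr 2
    omega

theorem stateTree_label_iterate (v : StateVertex (ZMod p) N) (n : ℕ) :
    (((stateTree hN f hf hnil).label ((parent f)^[n] v) : ℕ) : ZMod p) =
      (shift f)^[n] v.1.1 ⟨0, hN⟩ := by
  change ((toFin _ : ℕ) : ZMod p) = _
  rw [natCast_toFin, iterate_parent_state hf]

theorem stateTree_label_eq_zero {v : StateVertex (ZMod p) N} (h : lvl f v < N) :
    (stateTree hN f hf hnil).label v = 0 := by
  change toFin _ = 0
  rw [toFin_eq_zero_iff, state_eq_zero_of_lvl_lt hf hnil h]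
  rfl

theorem stateTree_isValid : (stateTree hN f hf hnil).IsValid N := by
  refine ⟨fun v hv => stateTree_label_eq_zero ((stateTree_level v).symm.trans_lt hv), fun α => ?_⟩
  -- Paths run away from the root while states are read towards it, so the labels are reversed.
  set β : Fin N → ZMod p := fun i => ((α ⟨N - 1 - i, by omega⟩ : ℕ) : ZMod p) with hβ
  refine ⟨fun i : Fin N => (parent f)^[N - 1 - i] (ofState hN β), ⟨?_, ?_⟩, ?_⟩
  · exact stateTree_isPath_iterate (by rw [lvl_ofState]; omega)
  · intro i
    change toFin _ = _
    rw [toFin_eq_iff, iterate_parent_state hf, iterate_shift_apply _ _ _ _ (by simp only; omega)]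
    simp only [ofState, hβ]
    congr 3
    ext
    simp only
    omega
  · rintro c ⟨hc, hlab⟩
    have hlast : c ⟨N - 1, by omega⟩ = ofState hN β := by
      have hl := IsPath.lvl_eq hc (N - 1) (by omega)
      rw [eq_ofState_of_le_lvl (f := f) hN (v := c ⟨N - 1, by omega⟩) (by omega)]
      congr 1
      funext j
      have h1 := IsPath.eq_iterate_parent hc (i := N - 1 - j) (j := N - 1) (n := j) (by omega)
        (by omega)
      have h2 := stateTree_label_iterate (hN := hN) (hf := hf) (hnil := hnil)
        (c ⟨N - 1, by omega⟩) j
      rw [← h1, iterate_shift_apply _ _ _ _ (by simp only; omega), hlab] at h2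
      exact h2.symm
    funext i
    have h1 := IsPath.eq_iterate_parent hc (i := i) (j := N - 1) (n := N - 1 - i) (by omega)
      (by omega)
    rw [← hlast]
    exact h1

theorem stateTree_height {D : ℕ} (hD : ∀ α, (shift f)^[D] α = 0)
    (hD' : ∃ α, ∀ n < D, (shift f)^[n] α ≠ 0) : (stateTree hN f hf hnil).height = D + N := by
  obtain ⟨α, hα⟩ := hD'
  have hs : steps f α = D := by
    refine le_antisymm (steps_le (hD α)) (not_lt.1 fun h => hα _ h ?_)
    exact iterate_shift_eq_zero hf (hnil α) le_rfl
  refine IsGreatest.csSup_eq ⟨⟨ofState hN α, ?_⟩, ?_⟩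
  · simp only
    rw [stateTree_level, lvl_ofState, hs]
    omega
  · rintro _ ⟨v, rfl⟩
    have h0 : (stateTree hN f hf hnil).level v = lvl f v := stateTree_level v
    have h1 := lvl_lt (f := f) v
    have h2 := steps_le (hD v.1.1)
    simp only
    omega

/-- Membership in `Ẽ`: the digit with the index `0` is the feedback of the preceding `N` digits,
and the later ones vanish. -/
theorem mem_stateTree_tilde (hex : ∃ α : Fin N → ZMod p, α ≠ 0) {χ : Dual p} :
    χ ∈ (stateTree hN f hf hnil).tilde N ↔
      digit χ 0 = f (fun i => digit χ (-N + i)) ∧ ∀ k, 1 ≤ k → digit χ k = 0 := by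
  constructor
  · rintro ⟨s, c, hc, hzero, q, hχ⟩
    rw [mem_coset_iff] at hχ
    rcases lt_or_ge (q : ℕ) N with hq | hq
    -- Reading back from one of the first N vertices meets zero labels only.
    · have h0 : ∀ k : ℤ, -N ≤ k → digit χ k = 0 := by
        intro k hk
        rw [hχ k hk]
        by_cases hk' : k < -N + ((min (q : ℕ) N + 1 : ℕ) : ℤ)
        · obtain ⟨i, rfl⟩ : ∃ i : ℕ, k = -N + i := ⟨(k + N).toNat, by omega⟩
          have hi : i < min (q : ℕ) N + 1 := by omega
          refine (digit_word_apply (-N : ℤ) _ ⟨i, hi⟩).trans ?_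
          rw [hzero _ (by simp only; omega), Fin.val_zero, Nat.cast_zero]
        · exact digit_word_of_ge _ (by omega)
      refine ⟨?_, fun k hk => h0 k (by omega)⟩
      rw [h0 0 (by omega)]
      have : (fun i : Fin N => digit χ (-N + i)) = 0 := funext fun i => h0 _ (by omega)
      rw [this, hf]
    -- Here N + 1 vertices are read, and going to the parent is a step of the register.
    · have hd : ∀ i : ℕ, i ≤ N → digit χ (-N + i) = (shift f)^[i] (c q).1.1 ⟨0, hN⟩ := by
        intro i hi
        have h1 := IsPath.eq_iterate_parent hc (i := q - i) (n := i) q.2 (by omega)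
        have h2 := stateTree_label_iterate (hN := hN) (hf := hf) (hnil := hnil) (c q) i
        rw [← h1] at h2
        rw [hχ _ (by omega)]
        exact (digit_word_apply (-N : ℤ) _ ⟨i, by omega⟩).trans h2
      constructor
      · have h0 := hd N le_rfl
        rw [neg_add_cancel, iterate_shift_head] at h0
        rw [h0]
        congr 1
        funext i
        rw [hd i i.2.le, iterate_shift_apply _ _ _ _ (by simp only; omega)]
        rfl
      · intro k hk
        rw [hχ k (by omega)]
        exact digit_word_of_ge _ (by omega)
  · rintro ⟨h0, h1⟩
    set α : Fin N → ZMod p := fun i => digit χ (-N + i) with hα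
    by_cases hz : α = 0
    -- The trivial coset also needs a path with at least N + 1 vertices: the one from the root to
    -- any nonzero state, read at its first vertex.
    · obtain ⟨β, hβ⟩ := hex
      have hs := steps_eq_succ hf hnil hβ
      have hl := lvl_ofState (f := f) hN β
      have hlab : ∀ i : Fin (steps f β - 1 + N + 1), (i : ℕ) < N →
          (stateTree hN f hf hnil).label
            ((parent f)^[steps f β - 1 + N + 1 - 1 - i] (ofState hN β)) = 0 := by
        intro i hi
        refine stateTree_label_eq_zero ?_
        rw [lvl_iterate_parent hf hnil hN]
        omega
      refine ⟨steps f β - 1, _, stateTree_isPath_iterate (v := ofState hN β) (by omega), hlab,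
        ⟨0, by omega⟩, mem_coset_iff.2 fun k hk => ?_⟩
      have hk0 : digit χ k = 0 := by
        rcases lt_trichotomy k 0 with hk' | rfl | hk'
        · have := congrFun hz ⟨(k + N).toNat, by omega⟩
          rw [hα] at this
          simp only [Pi.zero_apply] at this
          rw [← this]
          congr 1
          omega
        · rw [h0, hz, hf]
        · exact h1 k hk'
      rw [hk0, eq_comm]
      by_cases hk' : k = -N
      · subst hk'
        have := digit_word_apply (-N : ℤ) (fun i : Fin (min 0 N + 1) =>
          (stateTree hN f hf hnil).label
            ((parent f)^[steps f β - 1 + N + 1 - 1 - (0 - i)] (ofState hN β))) ⟨0, by omega⟩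
        rw [Nat.cast_zero, add_zero] at this
        refine this.trans ((congrArg (fun a : Fin p => ((a : ℕ) : ZMod p))
          (hlab ⟨0, by omega⟩ hN)).trans ?_)
        rw [Fin.val_zero, Nat.cast_zero]
      · exact digit_word_of_ge _ (by simp only; omega)
    -- The path from the root to α has `steps f α + N` vertices, so s = `steps f α - 1`; it is read
    -- back from its end.
    · have hs := steps_eq_succ hf hnil hz
      have hl := lvl_ofState (f := f) hN α
      refine ⟨steps f α - 1, _, stateTree_isPath_iterate (v := ofState hN α) (by omega), ?_,
        ⟨steps f α - 1 + N, by omega⟩, mem_coset_iff.2 fun k hk => ?_⟩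
      · intro i hi
        refine stateTree_label_eq_zero ?_
        rw [lvl_iterate_parent hf hnil hN]
        omega
      · by_cases hk' : k ≤ 0
        · obtain ⟨i, rfl⟩ : ∃ i : ℕ, k = -N + i := ⟨(k + N).toNat, by omega⟩
          have hi : i < min (steps f α - 1 + N) N + 1 := by omega
          refine Eq.symm ((digit_word_apply (-N : ℤ) _ ⟨i, hi⟩).trans ?_)
          rw [stateTree_label_iterate]
          have he : steps f α - 1 + N + 1 - 1 - (steps f α - 1 + N - i) = i := by omega
          simp only [he]
          rcases lt_or_eq_of_le (show i ≤ N by omega) with hiN | rfl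
          · rw [iterate_shift_apply _ _ _ _ (by simp only; omega)]
            rfl
          · rw [iterate_shift_head, neg_add_cancel, h0]
            rfl
        · rw [h1 k (by omega)]
          exact (digit_word_of_ge _ (by simp only; omega)).symm

end StateTree

/-- Periodic extension removes a condition on the digits with positive index. -/
theorem mem_periodicExtension {p : ℕ} [NeZero p] {S T : Set (Dual p)}
    (hS : ∀ χ, χ ∈ S ↔ χ ∈ T ∧ ∀ k, 1 ≤ k → digit χ k = 0)
    (hT : ∀ χ ψ : Dual p, (∀ k ≤ 0, digit χ k = digit ψ k) → χ ∈ T → ψ ∈ T) {χ : Dual p} :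
    χ ∈ periodicExtension S ↔ χ ∈ T := by
  constructor
  · rintro ⟨s, -, α, ψ, hψ, rfl⟩
    refine hT ψ _ (fun k hk => ?_) ((hS ψ).1 hψ).1
    rw [digit_mul, digit_word_of_lt _ (by omega), add_zero]
  · intro h
    obtain ⟨K, hK⟩ := exists_mem_annih χ
    -- The digits from K on vanish, so this length captures every nonzero digit of positive index;
    -- the extra 1 ensures s ≥ 1.
    set α : Fin (K.toNat + 1) → Fin p := fun i => toFin (digit χ (1 + i)) with hα
    refine ⟨K.toNat + 1, by omega, α, χ * (word 1 α)⁻¹, (hS _).2 ⟨hT χ _ (fun k hk => ?_) h,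
      fun k hk => ?_⟩, by rw [inv_mul_cancel_right]⟩
    · rw [digit_mul, digit_inv, digit_word_of_lt _ (by omega), neg_zero, add_zero]
    · rw [digit_mul, digit_inv]
      by_cases hk' : k < 1 + ((K.toNat + 1 : ℕ) : ℤ)
      · obtain ⟨i, rfl⟩ : ∃ i : ℕ, k = 1 + i := ⟨(k - 1).toNat, by omega⟩
        have := digit_word_apply (1 : ℤ) α ⟨i, by omega⟩
        simp only [hα, natCast_toFin] at this
        rw [this, add_neg_cancel]
      · rw [digit_word_of_ge _ (by omega), mem_annih_iff.1 hK k (by omega), neg_zero, add_zero]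

/-! ## Sets that are stable under a mask -/

section MaskSet

variable {p N : ℕ} [NeZero p] {E : Set (Dual p)}

/-- The digits of a character with the indices `-N, …, -1`. -/
def state (N : ℕ) (χ : Dual p) : Fin N → ZMod p := fun i => digit χ (-N + i)

/-- Modulo 𝔊_{-N}^⊥ the set is the graph of a function of the state, since the digits of a coset at
-N, …, -1 are its index α. -/
theorem exists_digits_of_isElementarySet {M : ℕ} (hE : IsElementarySet N M E) :
    (∀ β : Fin N → ZMod p, ∃ χ ∈ E, state N χ = β) ∧
    (∀ χ ∈ E, ∀ ψ ∈ E, state N χ = state N ψ → ∀ k : ℤ, -N ≤ k → digit χ k = digit ψ k) ∧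
    (∀ χ ∈ E, ∀ ψ : Dual p, (∀ k : ℤ, -N ≤ k → digit χ k = digit ψ k) → ψ ∈ E) ∧
    (1 : Dual p) ∈ E ∧
    ∀ l < M + N, (((annih p (-N + l + 1) : Set (Dual p)) \ annih p (-N + l)) ∩ E).Nonempty := by
  obtain ⟨η, rfl, -, -, -, hone, hne⟩ := hE
  have hdig : ∀ (α : Fin N → Fin p) (i : Fin N),
      digit (word (-N) α * word 0 (η α)) (-N + i) = ((α i : ℕ) : ZMod p) := fun α i => by
    rw [digit_mul, digit_word_apply, digit_word_of_lt _ (by omega), add_zero]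
  refine ⟨fun β => ?_, ?_, ?_, ?_, hne⟩
  · refine ⟨_, Set.mem_iUnion.2 ⟨fun i => toFin (β i), mem_coset_iff.2 fun _ _ => rfl⟩, ?_⟩
    funext i
    rw [state, hdig, natCast_toFin]
  · intro χ hχ ψ hψ hst k hk
    obtain ⟨α, hα⟩ := Set.mem_iUnion.1 hχ
    obtain ⟨β, hβ⟩ := Set.mem_iUnion.1 hψ
    rw [mem_coset_iff] at hα hβ
    have : α = β := by
      funext i
      have h := congrFun hst i
      rw [state, state, hα _ (by omega), hβ _ (by omega), hdig, hdig] at h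
      rw [← toFin_natCast (α i), h, toFin_natCast]
    subst this
    rw [hα k hk, hβ k hk]
  · intro χ hχ ψ h
    obtain ⟨α, hα⟩ := Set.mem_iUnion.1 hχ
    rw [mem_coset_iff] at hα
    exact Set.mem_iUnion.2 ⟨α, mem_coset_iff.2 fun k hk => by rw [← h k hk, hα k hk]⟩
  · refine Set.mem_iUnion.2 ⟨0, ?_⟩
    rw [hone]
    exact (annih p _).one_mem

/-- If the mask does not vanish at χ, some ψ ∈ E has the same digits at -N, …, 0; its digit at 0 is
forced by the state. Such a ψ comes from the ζ ∈ E that has the state of χ𝓐⁻¹. -/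
theorem mask_ne_zero_iff {m : Dual p → ℂ} (hm : IsMask N m)
    (hstep : ∀ χ, χ ∈ E ↔ m χ ≠ 0 ∧ (dualDilation p).symm χ ∈ E)
    (hex : ∀ β : Fin N → ZMod p, ∃ χ ∈ E, state N χ = β)
    (huniq : ∀ χ ∈ E, ∀ ψ ∈ E, state N χ = state N ψ → ∀ k : ℤ, -N ≤ k → digit χ k = digit ψ k)
    (hinv : ∀ χ ∈ E, ∀ ψ : Dual p, (∀ k : ℤ, -N ≤ k → digit χ k = digit ψ k) → ψ ∈ E)
    {ξ : Dual p} (hξ : ξ ∈ E) {χ : Dual p} (hst : state N ξ = state N χ) :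
    m χ ≠ 0 ↔ digit χ 0 = digit ξ 0 := by
  have hst' : ∀ k : ℤ, -N ≤ k → k < 0 → digit ξ k = digit χ k := by
    intro k hk hk'
    obtain ⟨i, rfl⟩ : ∃ i : ℕ, k = -N + i := ⟨(k + N).toNat, by omega⟩
    exact congrFun hst ⟨i, by omega⟩
  constructor
  · intro h
    obtain ⟨ζ, hζ, hζst⟩ := hex (state N ((dualDilation p).symm χ))
    have hζd : ∀ k : ℤ, -N ≤ k → k < 0 → digit ζ k = digit χ (k + 1) := by
      intro k hk hk'
      obtain ⟨i, rfl⟩ : ∃ i : ℕ, k = -N + i := ⟨(k + N).toNat, by omega⟩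
      rw [← digit_dualDilation_symm]
      exact congrFun hζst ⟨i, by omega⟩
    -- The digits of ζ𝓐 agree with those of χ at -N + 1, …, 0; the factor r_{-N}^c corrects the one
    -- at -N and does not affect membership of ψ𝓐⁻¹ in `E`.
    set c : ZMod p := digit χ (-N) - digit ζ (-N - 1) with hc
    set ψ : Dual p := rademacher p (-N) ^ c.val * dualDilation p ζ with hψ
    have hd : ∀ k : ℤ, digit ψ k = (if k = -N then c else 0) + digit ζ (k - 1) := by
      intro k
      rw [hψ, digit_mul, digit_pow, digit_rademacher, digit_dualDilation, ZMod.natCast_zmod_val]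
      simp
    have hψχ : ∀ k : ℤ, -N ≤ k → k ≤ 0 → digit ψ k = digit χ k := by
      intro k hk hk'
      rw [hd]
      split_ifs with h0
      · rw [h0, hc, sub_add_cancel]
      · rw [hζd _ (by omega) (by omega), zero_add, sub_add_cancel]
    have hψE : ψ ∈ E := by
      refine (hstep ψ).2 ⟨by rwa [hm.congr hψχ], hinv ζ hζ _ fun k hk => ?_⟩
      rw [digit_dualDilation_symm, hd, if_neg (by omega), zero_add, add_sub_cancel_right]
    rw [← hψχ 0 (by omega) le_rfl]
    refine huniq ψ hψE ξ hξ ?_ 0 (by omega)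
    rw [hst]
    exact funext fun i => hψχ _ (by omega) (by omega)
  · intro h
    have : m χ = m ξ := hm.congr fun k hk hk' => by
      rcases hk'.lt_or_eq with hk' | rfl
      · exact (hst' k hk hk').symm
      · exact h
    rw [this]
    exact ((hstep ξ).1 hξ).1

/-- After enough shifts every χ lies in 𝔊_{-N}^⊥ ⊂ E; the refinement step then leads back to χ. -/
theorem mem_iff_forall_mask_ne_zero {m : Dual p → ℂ}
    (hstep : ∀ χ, χ ∈ E ↔ m χ ≠ 0 ∧ (dualDilation p).symm χ ∈ E)
    (hinv : ∀ χ ∈ E, ∀ ψ : Dual p, (∀ k : ℤ, -N ≤ k → digit χ k = digit ψ k) → ψ ∈ E)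
    (hone : (1 : Dual p) ∈ E) {χ : Dual p} :
    χ ∈ E ↔ ∀ n : ℕ, m ((dualDilation p).symm^[n] χ) ≠ 0 := by
  constructor
  · intro h n
    have : (dualDilation p).symm^[n] χ ∈ E := by
      induction n with
      | zero => exact h
      | succ n ih =>
        rw [Function.iterate_succ_apply']
        exact ((hstep _).1 ih).2
    exact ((hstep _).1 this).1
  · intro h
    obtain ⟨K, hK⟩ := exists_mem_annih χ
    have hlast : (dualDilation p).symm^[(K + N).toNat] χ ∈ E := by
      refine hinv 1 hone _ fun k hk => ?_
      rw [digit_one, digit_iterate_dualDilation_symm, mem_annih_iff.1 hK _ (by omega)]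
    generalize (K + N).toNat = n at hlast
    induction n with
    | zero => exact hlast
    | succ n ih =>
      rw [Function.iterate_succ_apply'] at hlast
      exact ih ((hstep _).2 ⟨h n, hlast⟩)

/-- The digit that enters the state at index -1 is the former digit at 0, which is the feedback on
`E`. -/
theorem state_iterate_dualDilation_symm {f : (Fin N → ZMod p) → ZMod p}
    (hE : ∀ χ ∈ E, (dualDilation p).symm χ ∈ E) (hf : ∀ χ ∈ E, digit χ 0 = f (state N χ))
    {χ : Dual p} (hχ : χ ∈ E) (n : ℕ) :
    state N ((dualDilation p).symm^[n] χ) = (shift f)^[n] (state N χ) := by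
  induction n generalizing χ with
  | zero => rfl
  | succ n ih =>
    rw [Function.iterate_succ_apply, ih (hE χ hχ), Function.iterate_succ_apply]
    congr 1
    funext i
    rw [state, digit_dualDilation_symm, shift]
    split_ifs with h
    · rw [state]
      push_cast
      rw [add_assoc]
    · rw [← hf χ hχ]
      congr 1
      omega

end MaskSet

end Vilenkin

end

/-! ### The register that belongs to `E`, and its tree -/

theorem theorem4p1 (p : ℕ) [NeZero p] (hp : 3 ≤ p) (N M : ℕ) (hN : 1 ≤ N) (hM : 1 ≤ M)
    (E : Set (Vilenkin.Dual p)) (hEM : E ⊆ (Vilenkin.annih p M : Set (Vilenkin.Dual p)))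
    (hE : Vilenkin.IsElementarySet N M E)
    (φhat : Vilenkin.Dual p → ℂ) (hφ : Vilenkin.IsStep N M φhat)
    (hφE : ∀ χ, ‖φhat χ‖ = E.indicator (fun _ => (1 : ℝ)) χ)
    (m₀ : Vilenkin.Dual p → ℂ) (hm₀ : Vilenkin.IsElementaryMask N m₀)
    (href : ∀ χ, φhat χ = m₀ χ * φhat ((Vilenkin.dualDilation p).symm χ)) :
    ∃ T : Vilenkin.LabelledTree p,
      T.IsValid N ∧ T.height = M + 2 * N ∧ T.Generates N E := by
  open Vilenkin in
  have hmem : ∀ χ, χ ∈ E ↔ φhat χ ≠ 0 := by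
    intro χ
    rw [← norm_ne_zero_iff, hφE]
    by_cases h : χ ∈ E <;> simp [h]
  have hstep : ∀ χ, χ ∈ E ↔ m₀ χ ≠ 0 ∧ (dualDilation p).symm χ ∈ E := by
    intro χ
    rw [hmem, hmem, href χ, mul_ne_zero_iff]
  obtain ⟨hex, huniq, hinv, hone, hne⟩ := exists_digits_of_isElementarySet hE
  choose ξ hξE hξ using hex
  set f : (Fin N → ZMod p) → ZMod p := fun β => digit (ξ β) 0 with hf
  have hmask : ∀ χ, m₀ χ ≠ 0 ↔ digit χ 0 = f (state N χ) := fun χ =>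
    mask_ne_zero_iff hm₀.1 hstep (fun β => ⟨ξ β, hξE β, hξ β⟩) huniq hinv (hξE _) (hξ _)
  have hfE : ∀ χ ∈ E, digit χ 0 = f (state N χ) := fun χ h => (hmask χ).1 ((hstep χ).1 h).1
  have hf0 : f 0 = 0 := by
    have h1 := hfE 1 hone
    have h2 : state N (1 : Dual p) = 0 := funext fun i => digit_one _
    rw [digit_one, h2] at h1
    exact h1.symm
  have hiter : ∀ χ ∈ E, ∀ (n : ℕ) (i : Fin N),
      (shift f)^[n] (state N χ) i = digit χ (-N + i + n) := by
    intro χ h n i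
    rw [← state_iterate_dualDilation_symm (fun χ h => ((hstep χ).1 h).2) hfE h n, state,
      digit_iterate_dualDilation_symm]
  have hD : ∀ α, (shift f)^[M + N] α = 0 := by
    intro α
    funext i
    have h := hiter _ (hξE α) (M + N) i
    rw [hξ] at h
    -- The index is -N + i + (M + N) = M + i ≥ M.
    rw [h, mem_annih_iff.1 (hEM (hξE α)) _ (by push_cast; omega)]
    rfl
  have hD' : ∃ α, ∀ n < M + N, (shift f)^[n] α ≠ 0 := by
    -- An element of the last shell has a nonzero digit at M - 1, which is the head of the register
    -- after M + N - 1 steps. An empty register stays empty, so it is not empty earlier either.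
    obtain ⟨χ, ⟨h1, h2⟩, hχ⟩ := hne (M + N - 1) (by omega)
    refine ⟨state N χ, fun n hn h0 => h2 (mem_annih_of_mem_succ h1 ?_)⟩
    have h3 := hiter χ hχ (M + N - 1) ⟨0, hN⟩
    rw [show M + N - 1 = (M + N - 1 - n) + n by omega, Function.iterate_add_apply, h0,
      Function.iterate_fixed (shift_zero hf0)] at h3
    rw [Nat.sub_add_cancel (by omega)] at h3
    simp only [Nat.cast_zero, add_zero] at h3
    exact h3.symm
  refine ⟨stateTree hN f hf0 fun α => ⟨_, hD α⟩, stateTree_isValid, ?_, ?_⟩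
  · rw [stateTree_height hD hD']
    ring
  · ext χ
    rw [Set.mem_iInter, mem_iff_forall_mask_ne_zero hstep hinv hone]
    refine forall_congr' fun n => ?_
    -- The two descriptions now agree for each n: the periodic extension of `Ẽ` is the support of
    -- m₀.
    rw [mem_image_iterate_dualDilation, mem_periodicExtension (T := {χ | m₀ χ ≠ 0})]
    · rfl
    · intro ψ
      rw [mem_stateTree_tilde]
      · exact and_congr_left fun _ => (hmask ψ).symm
      · obtain ⟨α, hα⟩ := hD'
        exact ⟨α, hα 0 (by omega)⟩
    · intro ψ₁ ψ₂ h h1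
      rwa [Set.mem_ofPred_eq, ← hm₀.1.congr fun k _ hk => h k hk]
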